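/- Let $(M,\phi,\xi,\eta,g)$ be a $(2n+1)$-dimensional Kenmotsu manifold, that is, a smooth manifold $M$ of dimension $2n+1$ with a Riemannian metric $g$, a $(1,1)$-tensor field $\phi$, a vector field $\xi$ and a $1$-form $\eta$ (all smooth) such that $$\phi^2=-I+\eta\otimes\xi,\quad \eta(\xi)=1,\quad \eta=g(\xi,\cdot),\quad g(\phi\,\cdot,\phi\,\cdot)=g-\eta\otimes\eta,$$ and whose Levi-Civita connection $\nabla$ satisfies $(\nabla_X\phi)Y=g(\phi X,Y)\xi-\eta(Y)\phi X$ for all vector fields $X,Y$ on $M$. Let $a>0$ be a constant and let $\overline g=ag+a(a-1)\,\eta\otimes\eta$ be the metric of the $D$-homothetically deformed structure $(\overline\phi,\overline\xi,\overline\eta,\overline g)=(\phi,\tfrac1a\xi,a\eta,\overline g)$. Denote by $\overline\nabla$ and $\overline{\mathrm{Ric}}$ the Levi-Civita connection and the Ricci tensor of $\overline g$, by $\overline{\mathrm{grad}}(f)$ the $\overline g$-gradient of a function $f$, by $\overline{\mathrm{Hess}}(f)(X,Y)=\overline g(\overline\nabla_X\overline{\mathrm{grad}}(f),Y)$ its Hessian,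 by $\overline\Delta(f)$ the trace of $X\mapsto\overline\nabla_X\overline{\mathrm{grad}}(f)$, and by $|T|^2_{\overline g}=\sum_{i,j}T(e_i,e_j)^2$ (for a $\overline g$-orthonormal frame $(e_i)$) the squared Hilbert--Schmidt norm of a $(0,2)$-tensor field $T$. Let $f$ and $\overline\lambda$ be smooth functions on $M$ such that, with $V=\overline{\mathrm{grad}}(f)$, the pair $(V,\overline\lambda)$ defines a gradient almost Ricci soliton on $(M,\overline g)$, i.e. $$\tfrac12\pounds_V\overline g+\overline{\mathrm{Ric}}=\overline\lambda\,\overline g,$$ where $\pounds_V$ is the Lie derivative. Then, at every point of $M$, $$|\overline{\mathrm{Ric}}|^2_{\overline g}\ \ge\ |\overline{\mathrm{Hess}}(f)|^2_{\overline g}-\frac{1}{2n+1}\bigl(\overline\Delta(f)\bigr)^2 .$$ -/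

import Mathlib

open scoped Manifold ContDiff

noncomputable section

open Bundle FiberBundle NormedSpace Module VectorField
open scoped Topology


variable {E : Type*} [NormedAddCommGroup E] [NormedSpace ℝ E] [FiniteDimensional ℝ E]
  {H : Type*} [TopologicalSpace H] {I : ModelWithCorners ℝ E H}
  {M : Type*} [TopologicalSpace M] [ChartedSpace H M] [IsManifold I ∞ M]

namespace Riem

instance (x : M) : FiniteDimensional ℝ (TangentSpace I x) :=
  inferInstanceAs (FiniteDimensional ℝ E)
instance (x : M) : T2Space (TangentSpace I x) :=
  inferInstanceAs (T2Space E)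

-- `g` is a smooth Riemannian metric on `M`.
variable (g : ContMDiffRiemannianMetric I ∞ E (fun x : M ↦ TangentSpace I x))

theorem inner_injective (x : M) : Function.Injective (g.inner x).toLinearMap := by
  rw [injective_iff_map_eq_zero]
  intro v hv
  by_contra h
  have h1 := g.pos x v h
  have h2 : g.inner x v = 0 := hv
  rw [h2] at h1
  simp at h1

/-- The musical isomorphism `v ↦ g(v, ·)` from tangent vectors to covectors at `x`. -/
def flat (x : M) : TangentSpace I x ≃ₗ[ℝ] (TangentSpace I x →L[ℝ] ℝ) :=
  ((g.inner x).toLinearMap).linearEquivOfInjective (inner_injective g x) <| by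
    rw [← (LinearMap.toContinuousLinearMap (𝕜 := ℝ) (E := TangentSpace I x) (F' := ℝ)).finrank_eq]
    exact (Subspace.dual_finrank_eq (K := ℝ) (V := TangentSpace I x)).symm

theorem flat_apply (x : M) (v w : TangentSpace I x) : flat g x v w = g.inner x v w := rfl

theorem inner_flat_symm (x : M) (α : TangentSpace I x →L[ℝ] ℝ) (w : TangentSpace I x) :
    g.inner x ((flat g x).symm α) w = α w := by
  rw [← flat_apply, LinearEquiv.apply_symm_apply]

variable {g} in
theorem mdifferentiableAt_inner {X Y : Π x : M, TangentSpace I x} {x : M}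
    (hX : MDiffAt (T% X) x) (hY : MDiffAt (T% Y) x) :
    MDiffAt (fun y ↦ g.inner y (X y) (Y y)) x := by
  let : RiemannianBundle (fun x : M ↦ TangentSpace I x) := ⟨g.toRiemannianMetric⟩
  exact MDifferentiableAt.inner_bundle (IB := I) (F := E) (E := fun x : M ↦ TangentSpace I x) hX hY

/-- The right-hand side of the Koszul formula. -/
def koszul (Y X Z : Π x : M, TangentSpace I x) (x : M) : ℝ :=
  d% (fun y ↦ g.inner y (Y y) (Z y)) x (X x) + d% (fun y ↦ g.inner y (X y) (Z y)) x (Y x)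
    - d% (fun y ↦ g.inner y (X y) (Y y)) x (Z x)
    + g.inner x (mlieBracket I X Y x) (Z x) - g.inner x (mlieBracket I X Z x) (Y x)
    - g.inner x (mlieBracket I Y Z x) (X x)

theorem tensorial_koszul₁ {Y Z : Π x : M, TangentSpace I x} {x : M}
    (hY : MDiffAt (T% Y) x) (hZ : MDiffAt (T% Z) x) :
    TensorialAt I E (koszul g Y · Z x) x where
  smul {f X} hf hX := by
    have e1 := mvfderiv_fun_mul hf (mdifferentiableAt_inner (g := g) hX hZ)
    have e2 := mvfderiv_fun_mul hf (mdifferentiableAt_inner (g := g) hX hY)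
    simp only [koszul, mlieBracket_smul_left hf hX, Pi.smul_apply', map_smul, map_add,
      _root_.smul_apply, _root_.add_apply, smul_eq_mul, e1, e2]
    rw [g.symm x (X x) (Z x), g.symm x (X x) (Y x)]
    simp
    ring
  add {X X'} hX hX' := by
    have e1 := mvfderiv_fun_add (mdifferentiableAt_inner (g := g) hX hZ)
      (mdifferentiableAt_inner (g := g) hX' hZ)
    have e2 := mvfderiv_fun_add (mdifferentiableAt_inner (g := g) hX hY)
      (mdifferentiableAt_inner (g := g) hX' hY)
    simp only [koszul, mlieBracket_add_left hX hX', Pi.add_apply, map_add,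
      _root_.add_apply, e1, e2]
    ring

theorem tensorial_koszul₂ {X Y : Π x : M, TangentSpace I x} {x : M}
    (hX : MDiffAt (T% X) x) (hY : MDiffAt (T% Y) x) :
    TensorialAt I E (koszul g Y X · x) x where
  smul {f Z} hf hZ := by
    have e1 := mvfderiv_fun_mul hf (mdifferentiableAt_inner (g := g) hY hZ)
    have e2 := mvfderiv_fun_mul hf (mdifferentiableAt_inner (g := g) hX hZ)
    simp only [koszul, mlieBracket_smul_right hf hZ, Pi.smul_apply', map_smul, map_add,
      _root_.smul_apply, _root_.add_apply, smul_eq_mul, e1, e2]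
    rw [g.symm x (Z x) (X x), g.symm x (Z x) (Y x)]
    ring
  add {Z Z'} hZ hZ' := by
    have e1 := mvfderiv_fun_add (mdifferentiableAt_inner (g := g) hY hZ)
      (mdifferentiableAt_inner (g := g) hY hZ')
    have e2 := mvfderiv_fun_add (mdifferentiableAt_inner (g := g) hX hZ)
      (mdifferentiableAt_inner (g := g) hX hZ')
    simp only [koszul, mlieBracket_add_right hZ hZ', Pi.add_apply, map_add,
      _root_.add_apply, e1, e2]
    ring

/-- The Koszul expression of a vector field `Y` differentiable at `x`, as a bilinear form in the
values at `x` of the two other vector fields. -/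
def koszulForm (Y : Π x : M, TangentSpace I x) (x : M) (hY : MDiffAt (T% Y) x) :
    TangentSpace I x →L[ℝ] TangentSpace I x →L[ℝ] ℝ :=
  TensorialAt.mkHom₂ (fun X Z ↦ koszul g Y X Z x) x
    (fun _ hZ ↦ tensorial_koszul₁ g hY hZ) (fun _ hX ↦ tensorial_koszul₂ g hX hY)

theorem koszulForm_apply {X Y Z : Π x : M, TangentSpace I x} {x : M} (hX : MDiffAt (T% X) x)
    (hY : MDiffAt (T% Y) x) (hZ : MDiffAt (T% Z) x) :
    koszulForm g Y x hY (X x) (Z x) = koszul g Y X Z x :=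
  TensorialAt.mkHom₂_apply _ _ hX hZ

open scoped Classical in
/-- `∇_v Y` at `x`, as a linear function of `v`: the vector determined by the Koszul formula
`2 g(∇_X Y, Z) = X g(Y, Z) + Y g(X, Z) - Z g(X, Y) + g([X, Y], Z) - g([X, Z], Y) - g([Y, Z], X)`
(and `0` by convention where `Y` is not differentiable). -/
def leviCivitaFun (Y : Π x : M, TangentSpace I x) (x : M) :
    TangentSpace I x →L[ℝ] TangentSpace I x :=
  if hY : MDiffAt (T% Y) x then
    LinearMap.toContinuousLinearMap
      ((1 / 2 : ℝ) • ((flat g x).symm.toLinearMap ∘ₗ (koszulForm g Y x hY).toLinearMap))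
  else 0

theorem two_mul_inner_leviCivitaFun {X Y Z : Π x : M, TangentSpace I x} {x : M}
    (hX : MDiffAt (T% X) x) (hY : MDiffAt (T% Y) x) (hZ : MDiffAt (T% Z) x) :
    2 * g.inner x (leviCivitaFun g Y x (X x)) (Z x) = koszul g Y X Z x := by
  rw [← koszulForm_apply g hX hY hZ, ← inner_flat_symm g x (koszulForm g Y x hY (X x))]
  simp [leviCivitaFun, hY]

theorem leviCivitaFun_unique {Y : Π x : M, TangentSpace I x} {x : M} (hY : MDiffAt (T% Y) x)
    {A : TangentSpace I x →L[ℝ] TangentSpace I x}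
    (h : ∀ v w : TangentSpace I x,
      2 * g.inner x (A v) w = koszul g Y (extend E v) (extend E w) x) :
    leviCivitaFun g Y x = A := by
  ext v
  apply inner_injective g x
  ext w
  have h1 := two_mul_inner_leviCivitaFun g (mdifferentiableAt_extend I E v) hY
    (mdifferentiableAt_extend I E w)
  rw [← h v w] at h1
  simp only [extend_apply_self] at h1
  simpa using h1

/-- The Levi-Civita connection of `g`, with `∇_X Y` at `x` written `leviCivita g Y x (X x)`. -/
def leviCivita : CovariantDerivative I E (fun x : M ↦ TangentSpace I x) where
  toFun := leviCivitaFun g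
  isCovariantDerivativeOnUniv :=
    { add := by
        intro Y Y' x hY hY' _
        have hs : MDiffAt (T% (Y + Y')) x := mdifferentiableAt_add_section hY hY'
        refine leviCivitaFun_unique g hs fun v w ↦ ?_
        have hv := mdifferentiableAt_extend I E v
        have hw := mdifferentiableAt_extend I E w
        have h1 := two_mul_inner_leviCivitaFun g hv hY hw
        have h2 := two_mul_inner_leviCivitaFun g hv hY' hw
        have e1 := mvfderiv_fun_add (mdifferentiableAt_inner (g := g) hY hw)
          (mdifferentiableAt_inner (g := g) hY' hw)
        have e2 := mvfderiv_fun_add (mdifferentiableAt_inner (g := g) hv hY)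
          (mdifferentiableAt_inner (g := g) hv hY')
        simp only [extend_apply_self] at h1 h2
        simp only [koszul, mlieBracket_add_left hY hY', mlieBracket_add_right hY hY',
          Pi.add_apply, map_add, _root_.add_apply, e1, e2, extend_apply_self, mul_add, h1, h2]
        ring
      leibniz := by
        intro Y f x hY hf _
        have hs : MDiffAt (T% (f • Y)) x := hf.smul_section hY
        refine leviCivitaFun_unique g hs fun v w ↦ ?_
        have hv := mdifferentiableAt_extend I E v
        have hw := mdifferentiableAt_extend I E w
        have h1 := two_mul_inner_leviCivitaFun g hv hY hw
        have e1 := mvfderiv_fun_mul hf (mdifferentiableAt_inner (g := g) hY hw)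
        have e2 := mvfderiv_fun_mul hf (mdifferentiableAt_inner (g := g) hv hY)
        simp only [extend_apply_self] at h1
        simp only [koszul, mlieBracket_smul_left hf hY, mlieBracket_smul_right hf hY,
          Pi.smul_apply', map_smul, map_add, _root_.smul_apply, _root_.add_apply, smul_eq_mul,
          e1, e2, extend_apply_self, mul_add, ContinuousLinearMap.smulRight_apply,
          mul_left_comm (2 : ℝ) (f x), h1]
        rw [g.symm x (Y x) v]
        simp
        ring }

theorem two_mul_inner_leviCivita {X Y Z : Π x : M, TangentSpace I x} {x : M}
    (hX : MDiffAt (T% X) x) (hY : MDiffAt (T% Y) x) (hZ : MDiffAt (T% Z) x) :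
    2 * g.inner x (leviCivita g Y x (X x)) (Z x) = koszul g Y X Z x :=
  two_mul_inner_leviCivitaFun g hX hY hZ

theorem leviCivita_torsion : (leviCivita g).torsion = 0 := by
  rw [CovariantDerivative.torsion_eq_zero_iff]
  intro X Y x hX hY
  apply inner_injective g x
  ext w
  have hw := mdifferentiableAt_extend I E w
  have h1 := two_mul_inner_leviCivita g hX hY hw
  have h2 := two_mul_inner_leviCivita g hY hX hw
  have h3 : mlieBracket I Y X x = - mlieBracket I X Y x := mlieBracket_swap_apply
  have h4 : (fun y ↦ g.inner y (Y y) (X y)) = fun y ↦ g.inner y (X y) (Y y) := by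
    ext y; exact g.symm y _ _
  simp only [koszul, h3, h4, extend_apply_self, map_neg, _root_.neg_apply] at h1 h2
  simp
  linarith

theorem leviCivita_metric {X Y Z : Π x : M, TangentSpace I x} {x : M} (hX : MDiffAt (T% X) x)
    (hY : MDiffAt (T% Y) x) (hZ : MDiffAt (T% Z) x) :
    d% (fun y ↦ g.inner y (Y y) (Z y)) x (X x) =
      g.inner x (leviCivita g Y x (X x)) (Z x) + g.inner x (Y x) (leviCivita g Z x (X x)) := by
  have h1 := two_mul_inner_leviCivita g hX hY hZ
  have h2 := two_mul_inner_leviCivita g hX hZ hY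
  have h3 : mlieBracket I Z Y x = - mlieBracket I Y Z x := mlieBracket_swap_apply
  have h4 : (fun y ↦ g.inner y (Z y) (Y y)) = fun y ↦ g.inner y (Y y) (Z y) := by
    ext y; exact g.symm y _ _
  rw [g.symm x (Y x)]
  simp only [koszul, h3, h4, map_neg, _root_.neg_apply] at h1 h2
  linarith

/-- The curvature `R(X, Y)Z = ∇_X ∇_Y Z - ∇_Y ∇_X Z - ∇_[X, Y] Z` of `g`. -/
def curvature (X Y Z : Π x : M, TangentSpace I x) (x : M) : TangentSpace I x :=
  leviCivita g (fun y ↦ leviCivita g Z y (Y y)) x (X x)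
    - leviCivita g (fun y ↦ leviCivita g Z y (X y)) x (Y x)
    - leviCivita g Z x (mlieBracket I X Y x)

/-- A basis of the tangent space at `x` which is orthonormal for `g`. -/
def orthonormalFrame (x : M) : Basis (Fin (finrank ℝ (TangentSpace I x))) ℝ (TangentSpace I x) :=
  letI : RiemannianBundle (fun x : M ↦ TangentSpace I x) := ⟨g.toRiemannianMetric⟩
  (stdOrthonormalBasis ℝ (TangentSpace I x)).toBasis

theorem inner_orthonormalFrame (x : M) (i j : Fin (finrank ℝ (TangentSpace I x))) :
    g.inner x (orthonormalFrame g x i) (orthonormalFrame g x j) = if i = j then 1 else 0 := by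
  let : RiemannianBundle (fun x : M ↦ TangentSpace I x) := ⟨g.toRiemannianMetric⟩
  have h := (orthonormal_iff_ite (𝕜 := ℝ)).1 (stdOrthonormalBasis ℝ (TangentSpace I x)).orthonormal
    i j
  simp only [orthonormalFrame, OrthonormalBasis.coe_toBasis]
  exact h

/-- The Ricci tensor `Ric(v, w) = tr (u ↦ R(u, v)w) = ∑ i, g(R(e_i, v)w, e_i)` at `x`. The curvature
being tensorial, it is computed with any smooth local extensions of the tangent vectors. -/
def ricci (x : M) (v w : TangentSpace I x) : ℝ :=
  ∑ i, g.inner x (curvature g (extend E (orthonormalFrame g x i)) (extend E v) (extend E w) x)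
    (orthonormalFrame g x i)

/-- The gradient of `f`: `g(grad f, ·) = df`. -/
def gradient (f : M → ℝ) (x : M) : TangentSpace I x := (flat g x).symm (d% f x)

/-- The Hessian `Hess f (v, w) = g(∇_v grad f, w)` at `x`. -/
def hessian (f : M → ℝ) (x : M) (v w : TangentSpace I x) : ℝ :=
  g.inner x (leviCivita g (gradient g f) x v) w

/-- The divergence `div V = tr (v ↦ ∇_v V)`. -/
def divergence (V : Π x : M, TangentSpace I x) (x : M) : ℝ :=
  LinearMap.trace ℝ (TangentSpace I x) (leviCivita g V x).toLinearMap

/-- The Laplace operator `Δ f = div (grad f)`. -/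
def laplacian (f : M → ℝ) (x : M) : ℝ := divergence g (gradient g f) x

/-- The Lie derivative of the metric,
`(L_V g)(X, Y) = V g(X, Y) - g([V, X], Y) - g(X, [V, Y])`, at the tangent vectors `v`, `w` at `x`
(computed with local extensions of `v` and `w`, as it is tensorial in `X` and `Y`). -/
def lieDerivMetric (V : Π x : M, TangentSpace I x) (x : M) (v w : TangentSpace I x) : ℝ :=
  d% (fun y ↦ g.inner y (extend E v y) (extend E w y)) x (V x)
    - g.inner x (mlieBracket I V (extend E v) x) w
    - g.inner x v (mlieBracket I V (extend E w) x)

/-- The squared Hilbert-Schmidt norm `|T|² = ∑ i j, T(e_i, e_j)²` with respect to `g`, at `x`, of a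
`(0, 2)`-tensor `T`. -/
def hsNormSq (x : M) (T : TangentSpace I x → TangentSpace I x → ℝ) : ℝ :=
  ∑ i, ∑ j, T (orthonormalFrame g x i) (orthonormalFrame g x j) ^ 2

/-- `(V, lam)` is an almost Ricci soliton on `(M, g)`: `V` is a smooth vector field, `lam` is a
smooth function, and `(1/2) L_V g + Ric = lam g`. -/
structure IsAlmostRicciSoliton (V : Π x : M, TangentSpace I x) (lam : M → ℝ) : Prop where
  contMDiff_field : ContMDiff I I.tangent ∞ (fun x ↦ (⟨x, V x⟩ : TangentBundle I M))
  contMDiff_lam : ContMDiff I 𝓘(ℝ, ℝ) ∞ lam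
  eqn : ∀ (x : M) (v w : TangentSpace I x),
    (1 / 2 : ℝ) * lieDerivMetric g V x v w + ricci g x v w = lam x * g.inner x v w

end Riem

open Riem

variable (I M) in
/-- An almost contact metric structure `(φ, ξ, η, g)` on `M`. -/
structure AlmostContactMetricStructure where
  g : ContMDiffRiemannianMetric I ∞ E (fun x : M ↦ TangentSpace I x)
  φ : Π x : M, TangentSpace I x →L[ℝ] TangentSpace I x
  ξ : Π x : M, TangentSpace I x
  η : Π x : M, TangentSpace I x →L[ℝ] ℝ
  contMDiff_φ : ContMDiff I (I.prod 𝓘(ℝ, E →L[ℝ] E)) ∞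
    (fun x ↦ TotalSpace.mk' (E →L[ℝ] E) (E := fun x : M ↦ TangentSpace I x →L[ℝ] TangentSpace I x)
      x (φ x))
  contMDiff_ξ : ContMDiff I I.tangent ∞ (fun x ↦ (⟨x, ξ x⟩ : TangentBundle I M))
  contMDiff_η : ContMDiff I (I.prod 𝓘(ℝ, E →L[ℝ] ℝ)) ∞
    (fun x ↦ TotalSpace.mk' (E →L[ℝ] ℝ) (E := fun x : M ↦ TangentSpace I x →L[ℝ] ℝ) x (η x))
  φ_φ : ∀ (x : M) (v : TangentSpace I x), φ x (φ x v) = - v + η x v • ξ x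
  η_ξ : ∀ x : M, η x (ξ x) = 1
  η_eq : ∀ (x : M) (v : TangentSpace I x), η x v = g.inner x (ξ x) v
  inner_φ_φ : ∀ (x : M) (v w : TangentSpace I x),
    g.inner x (φ x v) (φ x w) = g.inner x v w - η x v * η x w

namespace AlmostContactMetricStructure

variable (S : AlmostContactMetricStructure I M)

/-- `(M, φ, ξ, η, g)` is a Kenmotsu manifold: `(∇_X φ)Y = g(φX, Y)ξ - η(Y)φX` for all smooth vector
fields `X`, `Y`, where `(∇_X φ)Y = ∇_X (φY) - φ(∇_X Y)`. -/
def IsKenmotsu : Prop :=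
  ∀ X Y : Π x : M, TangentSpace I x,
    ContMDiff I I.tangent ∞ (fun x ↦ (⟨x, X x⟩ : TangentBundle I M)) →
    ContMDiff I I.tangent ∞ (fun x ↦ (⟨x, Y x⟩ : TangentBundle I M)) →
    ∀ x : M, leviCivita S.g (fun y ↦ S.φ y (Y y)) x (X x) - S.φ x (leviCivita S.g Y x (X x)) =
      S.g.inner x (S.φ x (X x)) (Y x) • S.ξ x - S.η x (Y x) • S.φ x (X x)

theorem φ_ξ (x : M) : S.φ x (S.ξ x) = 0 := by
  by_contra h
  have h1 := S.g.pos x _ h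
  rw [S.inner_φ_φ, ← S.η_eq, S.η_ξ] at h1
  norm_num at h1

theorem η_φ (x : M) (v : TangentSpace I x) : S.η x (S.φ x v) = 0 := by
  have h1 := S.φ_φ x (S.φ x v)
  rw [S.φ_φ x v, map_add, map_neg, map_smul, S.φ_ξ, smul_zero] at h1
  have h2 := congrArg (S.η x) (add_left_cancel h1)
  rw [map_smul, S.η_ξ] at h2
  simpa using h2.symm

theorem contMDiff_deform (a : ℝ) :
    ContMDiff I (I.prod 𝓘(ℝ, E →L[ℝ] E →L[ℝ] ℝ)) ∞
      (fun x ↦ TotalSpace.mk' (E →L[ℝ] E →L[ℝ] ℝ)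
        (E := fun x : M ↦ TangentSpace I x →L[ℝ] TangentSpace I x →L[ℝ] ℝ)
        x (a • S.g.inner x + (a * (a - 1)) • (S.η x).smulRight (S.η x))) := by
  have h : ContMDiff I (I.prod 𝓘(ℝ, E →L[ℝ] E →L[ℝ] ℝ)) ∞
      (fun x ↦ TotalSpace.mk' (E →L[ℝ] E →L[ℝ] ℝ)
        (E := fun x : M ↦ TangentSpace I x →L[ℝ] TangentSpace I x →L[ℝ] ℝ)
        x ((S.η x).smulRight (S.η x))) := by
    intro x
    have hη := S.contMDiff_η x
    rw [contMDiffAt_hom_bundle] at hη ⊢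
    refine ⟨contMDiffAt_id, ?_⟩
    have hc : ContDiff ℝ ∞ (fun c : E →L[ℝ] ℝ ↦ c.smulRight c) :=
      contDiff_id.smulRight contDiff_id
    have h2 := hc.contMDiff.contMDiffAt.comp x hη.2
    refine h2.congr_of_eventuallyEq ?_
    have hb : ∀ᶠ y in 𝓝 x, y ∈ (trivializationAt E (fun x : M ↦ TangentSpace I x) x).baseSet :=
      (trivializationAt E (fun x : M ↦ TangentSpace I x) x).open_baseSet.mem_nhds
        (mem_baseSet_trivializationAt' x)
    filter_upwards [hb] with y hy
    ext v w
    have e := inCoordinates_apply_eq₂ (𝕜 := ℝ) (F₁ := E) (F₂ := E) (F₃ := ℝ)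
      (E₁ := fun x : M ↦ TangentSpace I x) (E₂ := fun x : M ↦ TangentSpace I x)
      (E₃ := Bundle.Trivial M ℝ) (x₀ := x) (x := y) (ϕ := (S.η y).smulRight (S.η y))
      (v := v) (w := w) hy hy (Set.mem_univ _)
    refine e.trans ?_
    simp [ContinuousLinearMap.inCoordinates]
    rw [Bundle.Trivialization.symmL_apply, Bundle.Trivialization.symmL_apply]
    all_goals exact hy
  exact (S.g.contMDiff.const_smul_section (a := a)).add_section
    (h.const_smul_section (a := a * (a - 1)))

theorem le_deform (a : ℝ) (ha : 0 < a) (x : M) (v : TangentSpace I x) :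
    a * a * S.g.inner x v v ≤
      (1 + a) * (a * S.g.inner x v v + a * (a - 1) * (S.η x v * S.η x v)) := by
  have h2 := S.inner_φ_φ x v v
  have h3 : 0 ≤ S.g.inner x (S.φ x v) (S.φ x v) := by
    by_cases h : S.φ x v = 0
    · simp [h]
    · exact (S.g.pos x _ h).le
  have h4 : S.g.inner x v v = S.g.inner x (S.φ x v) (S.φ x v) + S.η x v * S.η x v := by linarith
  rw [h4]
  have h5 := mul_nonneg ha.le h3
  have h6 := mul_nonneg (pow_pos ha 3).le (mul_self_nonneg (S.η x v))
  nlinarith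

/-- The metric `a g + a (a - 1) η ⊗ η` of the `D`-homothetic deformation. -/
def deformMetric (a : ℝ) (ha : 0 < a) :
    ContMDiffRiemannianMetric I ∞ E (fun x : M ↦ TangentSpace I x) where
  inner x := a • S.g.inner x + (a * (a - 1)) • (S.η x).smulRight (S.η x)
  symm x v w := by
    have h := S.g.symm x v w
    simp only [_root_.add_apply, _root_.smul_apply, ContinuousLinearMap.smulRight_apply,
      smul_eq_mul, h]
    ring
  pos x v hv := by
    have h1 := S.g.pos x v hv
    have h3 := mul_le_mul_of_nonneg_left (S.le_deform a ha x v) (mul_pos ha ha).le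
    by_contra h
    push Not at h
    have h4 : (1 + a) * (a * S.g.inner x v v + a * (a - 1) * (S.η x v * S.η x v)) ≤ 0 :=
      mul_nonpos_of_nonneg_of_nonpos (by linarith) (by simpa using h)
    have h5 : 0 < a * a * S.g.inner x v v := mul_pos (mul_pos ha ha) h1
    have h6 := S.le_deform a ha x v
    linarith
  isVonNBounded x := by
    have hc : 0 < (1 + a) / a := by positivity
    refine ((S.g.isVonNBounded x).image
      (((1 + a) / a) • ContinuousLinearMap.id ℝ (TangentSpace I x))).subset ?_
    intro v hv
    refine ⟨((1 + a) / a)⁻¹ • v, ?_, ?_⟩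
    swap
    · change ((1 + a) / a) • (((1 + a) / a)⁻¹ • v) = v
      rw [smul_smul, mul_inv_cancel₀ hc.ne', one_smul]
    have h1 := S.le_deform a ha x v
    have h2 : a * S.g.inner x v v + a * (a - 1) * (S.η x v * S.η x v) < 1 := by simpa using hv
    have h3 : a * a * S.g.inner x v v < (1 + a) * (1 + a) := by nlinarith
    simp only [Set.mem_ofPred_eq, map_smul, _root_.smul_apply, smul_eq_mul, inv_div]
    rw [← mul_assoc, div_mul_div_comm, div_mul_eq_mul_div, div_lt_one (by positivity)]
    exact h3
  contMDiff := S.contMDiff_deform a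

/-- The `D`-homothetic deformation
`(φ, (1/a) ξ, a η, a g + a (a - 1) η ⊗ η)` of `(φ, ξ, η, g)`, for a constant `a > 0`. -/
def deform (a : ℝ) (ha : 0 < a) : AlmostContactMetricStructure I M where
  g := S.deformMetric a ha
  φ := S.φ
  ξ := fun x ↦ (1 / a) • S.ξ x
  η := fun x ↦ a • S.η x
  contMDiff_φ := S.contMDiff_φ
  contMDiff_ξ := S.contMDiff_ξ.const_smul_section (a := 1 / a)
  contMDiff_η := S.contMDiff_η.const_smul_section (a := a)
  φ_φ x v := by
    rw [S.φ_φ]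
    simp [smul_smul]
    field_simp
  η_ξ x := by
    simp [S.η_ξ, ha.ne']
  η_eq x v := by
    simp [deformMetric, S.η_ξ, ← S.η_eq]
    field_simp
    ring
  inner_φ_φ x v w := by
    have h := S.inner_φ_φ x v w
    simp only [deformMetric, _root_.add_apply, _root_.smul_apply,
      ContinuousLinearMap.smulRight_apply, smul_eq_mul, h, S.η_φ]
    ring

end AlmostContactMetricStructure
end

/-!
Polarising `L_V g` with the Levi-Civita connection, and using that the Hessian is symmetric because
the connection has no torsion, turns the soliton equation into `Ric = lam g - Hess f`. Hence the
trace-free parts of `Ric` and `Hess f` are opposite, and in dimension `N`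
`|Ric|² - scal² / N = |Hess f|² - (Δ f)² / N`.
The inequality drops `scal² / N ≥ 0`.
-/

noncomputable section

open Bundle FiberBundle Module VectorField
open scoped Topology

namespace Riem

section LieBracket

variable {E : Type*} [NormedAddCommGroup E] [NormedSpace ℝ E]
  {F : Type*} [NormedAddCommGroup F] [NormedSpace ℝ F]
  {H : Type*} [TopologicalSpace H] {I : ModelWithCorners ℝ E H}
  {M : Type*} [TopologicalSpace M] [ChartedSpace H M]
  {f : M → F} {x : M}

theorem fderivWithin_mpullbackWithin_extChartAt_symm [IsManifold I 1 M] {z : E}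
    (hz : z ∈ (extChartAt I x).target) (hf : MDiffAt f ((extChartAt I x).symm z))
    (V : Π x : M, TangentSpace I x) :
    fderivWithin ℝ (f ∘ (extChartAt I x).symm) (Set.range I) z
        (mpullbackWithin 𝓘(ℝ, E) I (extChartAt I x).symm V (Set.range I) z) =
      d% f ((extChartAt I x).symm z) (V ((extChartAt I x).symm z)) := by
  have hchain := mfderiv_comp_mfderivWithin z hf
    (mdifferentiableWithinAt_extChartAt_symm hz)
    (I.uniqueMDiffOn z (extChartAt_target_subset_range x hz))
  rw [mfderivWithin_eq_fderivWithin] at hchain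
  rw [mpullbackWithin_apply]
  refine (DFunLike.congr_fun hchain _).trans ?_
  exact congrArg (d% f ((extChartAt I x).symm z))
    ((isInvertible_mfderivWithin_extChartAt_symm hz).self_apply_inverse _)

theorem mpullbackWithin_extChartAt_symm_self [IsManifold I 1 M]
    (V : Π x : M, TangentSpace I x) (x : M) :
    (mpullbackWithin 𝓘(ℝ, E) I (extChartAt I x).symm V (Set.range I) (extChartAt I x x) : E) =
      V x := by
  rw [← mfderivWithin_extChartAt_symm_inverse_apply (V x), mpullbackWithin_apply]
  congr 1
  exact congrArg (fun y ↦ (V y : E)) (extChartAt_to_inv x)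

theorem mlieBracket_eq_lieBracketWithin_mpullbackWithin [IsManifold I 1 M]
    (X Y : Π x : M, TangentSpace I x) (x : M) :
    (mlieBracket I X Y x : E) =
      lieBracketWithin ℝ (mpullbackWithin 𝓘(ℝ, E) I (extChartAt I x).symm X (Set.range I))
        (mpullbackWithin 𝓘(ℝ, E) I (extChartAt I x).symm Y (Set.range I)) (Set.range I)
        (extChartAt I x x) := by
  rw [← mlieBracketWithin_univ, mlieBracketWithin_apply, mfderiv_extChartAt_self,
    Set.preimage_univ, Set.univ_inter]
  exact congrArg (fun A : E →L[ℝ] E ↦ A _) (ContinuousLinearMap.inverse_id (R := ℝ) (M := E))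

variable [IsManifold I 2 M]

theorem mvfderiv_apply_comp_extChartAt_symm_eventuallyEq (hf : ContMDiffAt I 𝓘(ℝ, F) 2 f x)
    (V : Π x : M, TangentSpace I x) :
    (fun y ↦ d% f y (V y)) ∘ (extChartAt I x).symm =ᶠ[𝓝[Set.range I] (extChartAt I x x)]
      fun z ↦ fderivWithin ℝ (f ∘ (extChartAt I x).symm) (Set.range I) z
        (mpullbackWithin 𝓘(ℝ, E) I (extChartAt I x).symm V (Set.range I) z) := by
  have hsymm : Filter.Tendsto (extChartAt I x).symm (𝓝[Set.range I] (extChartAt I x x)) (𝓝 x) := by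
    simpa only [extChartAt_to_inv] using
      (continuousAt_extChartAt_symm (I := I) x).tendsto.mono_left nhdsWithin_le_nhds
  filter_upwards [extChartAt_target_mem_nhdsWithin (I := I) x,
    hsymm.eventually ((contMDiffAt_iff_contMDiffAt_nhds (by simp)).1 hf)] with z hz hfz
  exact (fderivWithin_mpullbackWithin_extChartAt_symm hz
    (hfz.mdifferentiableAt two_ne_zero) V).symm

variable [CompleteSpace E]

theorem differentiableWithinAt_mpullbackWithin_extChartAt_symm {V : Π x : M, TangentSpace I x}
    (hV : MDiffAt (T% V) x) :
    DifferentiableWithinAt ℝ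
      (mpullbackWithin 𝓘(ℝ, E) I (extChartAt I x).symm V (Set.range I) : E → E) (Set.range I)
      (extChartAt I x x) := by
  simpa only [Set.preimage_univ, Set.univ_inter] using
    (hV.mdifferentiableWithinAt (s := Set.univ)).differentiableWithinAt_mpullbackWithin_vectorField

theorem mdifferentiableAt_mvfderiv_apply (hf : ContMDiffAt I 𝓘(ℝ, F) 2 f x)
    {V : Π x : M, TangentSpace I x} (hV : MDiffAt (T% V) x) :
    MDiffAt (fun y ↦ d% f y (V y)) x := by
  have hderiv := (((contMDiffAt_iff.1 hf).2.fderivWithin_right I.uniqueDiffOn (m := 1)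
    le_rfl (Set.mem_range_self _)).differentiableWithinAt one_ne_zero).clm_apply
    (differentiableWithinAt_mpullbackWithin_extChartAt_symm hV)
  rw [← mdifferentiableWithinAt_univ]
  refine DifferentiableWithinAt.mdifferentiableWithinAt_of_comp_extChartAt_symm ?_
  simp only [Set.preimage_univ, Set.univ_inter]
  exact hderiv.congr_of_eventuallyEq_of_mem
    (mvfderiv_apply_comp_extChartAt_symm_eventuallyEq hf V) (Set.mem_range_self _)

theorem mvfderiv_mvfderiv_apply (hf : ContMDiffAt I 𝓘(ℝ, F) 2 f x)
    {V : Π x : M, TangentSpace I x} (hV : MDiffAt (T% V) x) (v : TangentSpace I x) :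
    d% (fun y ↦ d% f y (V y)) x v =
      fderivWithin ℝ (fun z ↦ fderivWithin ℝ (f ∘ (extChartAt I x).symm) (Set.range I) z
        (mpullbackWithin 𝓘(ℝ, E) I (extChartAt I x).symm V (Set.range I) z)) (Set.range I)
        (extChartAt I x x) v := by
  rw [(mdifferentiableAt_mvfderiv_apply hf hV).mvfderiv]
  congr 1
  exact (mvfderiv_apply_comp_extChartAt_symm_eventuallyEq hf V).fderivWithin_eq_of_mem
    (Set.mem_range_self _)

theorem mvfderiv_mlieBracket (hf : ContMDiffAt I 𝓘(ℝ, F) 2 f x)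
    {X Y : Π x : M, TangentSpace I x} (hX : MDiffAt (T% X) x) (hY : MDiffAt (T% Y) x) :
    d% f x (mlieBracket I X Y x) =
      d% (fun y ↦ d% f y (Y y)) x (X x) - d% (fun y ↦ d% f y (X y)) x (Y x) := by
  have hrange : extChartAt I x x ∈ Set.range I := Set.mem_range_self _
  have hcoord := fderivWithin_apply_lieBracket (contMDiffAt_iff.1 hf).2 (by simp) I.uniqueDiffOn
    (I.range_subset_closure_interior hrange) hrange
    (differentiableWithinAt_mpullbackWithin_extChartAt_symm hY)
    (differentiableWithinAt_mpullbackWithin_extChartAt_symm hX)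
  rw [mpullbackWithin_extChartAt_symm_self, mpullbackWithin_extChartAt_symm_self] at hcoord
  rw [mvfderiv_mvfderiv_apply hf hX, mvfderiv_mvfderiv_apply hf hY,
    (hf.mdifferentiableAt two_ne_zero).mvfderiv, mlieBracket_eq_lieBracketWithin_mpullbackWithin]
  exact hcoord

end LieBracket

section Riemannian

variable {E : Type*} [NormedAddCommGroup E] [NormedSpace ℝ E] [FiniteDimensional ℝ E]
  {H : Type*} [TopologicalSpace H] {I : ModelWithCorners ℝ E H}
  {M : Type*} [TopologicalSpace M] [ChartedSpace H M] [IsManifold I ∞ M]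
  {g : ContMDiffRiemannianMetric I ∞ E (fun x : M ↦ TangentSpace I x)}
  {f lam : M → ℝ} {x : M}

theorem inner_gradient (f : M → ℝ) (x : M) (v : TangentSpace I x) :
    g.inner x (gradient g f x) v = d% f x v :=
  inner_flat_symm g x _ v

theorem leviCivita_sub_leviCivita {X Y : Π x : M, TangentSpace I x}
    (hX : MDiffAt (T% X) x) (hY : MDiffAt (T% Y) x) :
    leviCivita g Y x (X x) - leviCivita g X x (Y x) = mlieBracket I X Y x :=
  (CovariantDerivative.torsion_eq_zero_iff _).1 (leviCivita_torsion g) hX hY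

theorem hessian_eq_mvfderiv_mvfderiv_sub (hG : MDiffAt (T% (gradient g f)) x)
    {X Y : Π x : M, TangentSpace I x} (hX : MDiffAt (T% X) x) (hY : MDiffAt (T% Y) x) :
    hessian g f x (X x) (Y x) =
      d% (fun y ↦ d% f y (Y y)) x (X x) - d% f x (leviCivita g Y x (X x)) := by
  have hmetric := leviCivita_metric g hX hG hY
  simp only [inner_gradient] at hmetric
  exact eq_sub_of_add_eq hmetric.symm

theorem hessian_symm (hf : ContMDiffAt I 𝓘(ℝ, ℝ) 2 f x) (hG : MDiffAt (T% (gradient g f)) x)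
    (v w : TangentSpace I x) :
    hessian g f x v w = hessian g f x w v := by
  have hv := mdifferentiableAt_extend I E v
  have hw := mdifferentiableAt_extend I E w
  have hbracket := mvfderiv_mlieBracket hf hv hw
  rw [← leviCivita_sub_leviCivita (g := g) hv hw, map_sub] at hbracket
  have hvw := hessian_eq_mvfderiv_mvfderiv_sub hG hv hw
  have hwv := hessian_eq_mvfderiv_mvfderiv_sub hG hw hv
  simp only [extend_apply_self] at hbracket hvw hwv
  linarith

theorem lieDerivMetric_eq {V : Π x : M, TangentSpace I x} (hV : MDiffAt (T% V) x)
    (v w : TangentSpace I x) :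
    lieDerivMetric g V x v w =
      g.inner x (leviCivita g V x v) w + g.inner x (leviCivita g V x w) v := by
  have hv := mdifferentiableAt_extend I E v
  have hw := mdifferentiableAt_extend I E w
  rw [lieDerivMetric, leviCivita_metric g hV hv hw, ← leviCivita_sub_leviCivita (g := g) hV hv,
    ← leviCivita_sub_leviCivita (g := g) hV hw]
  simp only [extend_apply_self, map_sub, _root_.sub_apply]
  rw [g.symm x v (leviCivita g V x w)]
  ring

theorem lieDerivMetric_gradient (hf : ContMDiffAt I 𝓘(ℝ, ℝ) 2 f x)
    (hG : MDiffAt (T% (gradient g f)) x) (v w : TangentSpace I x) :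
    lieDerivMetric g (gradient g f) x v w = 2 * hessian g f x v w := by
  calc lieDerivMetric g (gradient g f) x v w
    _ = hessian g f x v w + hessian g f x w v := lieDerivMetric_eq hG v w
    _ = 2 * hessian g f x v w := by rw [hessian_symm hf hG w v, two_mul]

variable (g) in
/-- The trace `tr_g T = ∑ i, T(e_i, e_i)` with respect to `g`, at `x`, of a `(0, 2)`-tensor `T`,
represented as in `hsNormSq` by its values on pairs of tangent vectors. -/
def metricTrace (x : M) (T : TangentSpace I x → TangentSpace I x → ℝ) : ℝ :=
  ∑ i, T (orthonormalFrame g x i) (orthonormalFrame g x i)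

variable (g) in
/-- The scalar curvature: the metric trace of the Ricci tensor. -/
def scalarCurvature (x : M) : ℝ := metricTrace g x (ricci g x)

theorem inner_orthonormalFrame_eq_repr (x : M) (v : TangentSpace I x)
    (i : Fin (finrank ℝ (TangentSpace I x))) :
    g.inner x v (orthonormalFrame g x i) = (orthonormalFrame g x).repr v i := by
  conv_lhs => rw [← (orthonormalFrame g x).sum_repr v]
  simp only [map_sum, map_smul, _root_.sum_apply, _root_.smul_apply, inner_orthonormalFrame,
    smul_eq_mul, mul_ite, mul_one, mul_zero, Finset.sum_ite_eq', Finset.mem_univ, if_true]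

theorem trace_eq_metricTrace (A : TangentSpace I x →ₗ[ℝ] TangentSpace I x) :
    LinearMap.trace ℝ (TangentSpace I x) A = metricTrace g x (fun v w ↦ g.inner x (A v) w) := by
  simp only [LinearMap.trace_eq_matrix_trace ℝ (orthonormalFrame g x), Matrix.trace,
    Matrix.diag_apply, LinearMap.toMatrix_apply, metricTrace, inner_orthonormalFrame_eq_repr]

theorem laplacian_eq_metricTrace_hessian (f : M → ℝ) (x : M) :
    laplacian g f x = metricTrace g x (hessian g f x) :=
  trace_eq_metricTrace _

theorem metricTrace_smul_inner_sub (c : ℝ) (T : TangentSpace I x → TangentSpace I x → ℝ) :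
    metricTrace g x (fun v w ↦ c * g.inner x v w - T v w) =
      finrank ℝ E * c - metricTrace g x T := by
  have hfinrank : finrank ℝ (TangentSpace I x) = finrank ℝ E := rfl
  simp [metricTrace, inner_orthonormalFrame, hfinrank]

theorem hsNormSq_smul_inner_sub (c : ℝ) (T : TangentSpace I x → TangentSpace I x → ℝ) :
    hsNormSq g x (fun v w ↦ c * g.inner x v w - T v w) =
      hsNormSq g x T - 2 * c * metricTrace g x T + finrank ℝ E * c ^ 2 := by
  have hfinrank : finrank ℝ (TangentSpace I x) = finrank ℝ E := rfl
  have hsq (i j : Fin (finrank ℝ (TangentSpace I x))) (t : ℝ) :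
      (c * (if i = j then 1 else 0) - t) ^ 2 =
        t ^ 2 - (if i = j then 2 * c * t else 0) + if i = j then c ^ 2 else 0 := by
    split_ifs <;> ring
  simp only [hsNormSq, metricTrace, inner_orthonormalFrame, hsq, Finset.sum_add_distrib,
    Finset.sum_sub_distrib, Finset.sum_ite_eq, Finset.mem_univ, if_true, Finset.mul_sum,
    Finset.sum_const, Finset.card_univ, Fintype.card_fin, hfinrank, nsmul_eq_mul]

theorem IsAlmostRicciSoliton.ricci_eq (h : IsAlmostRicciSoliton g (gradient g f) lam)
    (hf : ContMDiffAt I 𝓘(ℝ, ℝ) 2 f x) :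
    ricci g x = fun v w ↦ lam x * g.inner x v w - hessian g f x v w := by
  have hG : MDiffAt (T% (gradient g f)) x := h.contMDiff_field.mdifferentiableAt (by simp)
  ext v w
  linarith [h.eqn x v w, lieDerivMetric_gradient hf hG v w]

theorem IsAlmostRicciSoliton.scalarCurvature_eq (h : IsAlmostRicciSoliton g (gradient g f) lam)
    (hf : ContMDiffAt I 𝓘(ℝ, ℝ) 2 f x) :
    scalarCurvature g x = finrank ℝ E * lam x - laplacian g f x := by
  rw [scalarCurvature, h.ricci_eq hf, metricTrace_smul_inner_sub, laplacian_eq_metricTrace_hessian]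

theorem IsAlmostRicciSoliton.hsNormSq_ricci_sub_scalarCurvature_sq [Nontrivial E]
    (h : IsAlmostRicciSoliton g (gradient g f) lam) (hf : ContMDiffAt I 𝓘(ℝ, ℝ) 2 f x) :
    hsNormSq g x (ricci g x) - 1 / (finrank ℝ E : ℝ) * scalarCurvature g x ^ 2 =
      hsNormSq g x (hessian g f x) - 1 / (finrank ℝ E : ℝ) * laplacian g f x ^ 2 := by
  have hdim : (finrank ℝ E : ℝ) ≠ 0 := Nat.cast_ne_zero.2 finrank_pos.ne'
  rw [h.scalarCurvature_eq hf, h.ricci_eq hf, hsNormSq_smul_inner_sub,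
    ← laplacian_eq_metricTrace_hessian]
  field_simp
  ring

end Riemannian

end Riem

theorem mainTheorem8_general
    {E : Type*} [NormedAddCommGroup E] [NormedSpace ℝ E] [FiniteDimensional ℝ E] [Nontrivial E]
    {H : Type*} [TopologicalSpace H] {I : ModelWithCorners ℝ E H}
    {M : Type*} [TopologicalSpace M] [ChartedSpace H M] [IsManifold I ∞ M]
    (g : ContMDiffRiemannianMetric I ∞ E (fun x : M ↦ TangentSpace I x))
    (f lam : M → ℝ) (hf : ContMDiff I 𝓘(ℝ, ℝ) 2 f)
    (hsol : Riem.IsAlmostRicciSoliton g (Riem.gradient g f) lam) (x : M) :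
    Riem.hsNormSq g x (Riem.hessian g f x)
        - 1 / (finrank ℝ E : ℝ) * Riem.laplacian g f x ^ 2
      ≤ Riem.hsNormSq g x (Riem.ricci g x) := by
  rw [← hsol.hsNormSq_ricci_sub_scalarCurvature_sq (hf x)]
  exact sub_le_self _ (by positivity)

end

theorem mainTheorem8 (n : ℕ) {M : Type*} [TopologicalSpace M] [T2Space M]
    [SecondCountableTopology M] [ChartedSpace (EuclideanSpace ℝ (Fin (2 * n + 1))) M]
    [IsManifold (𝓡 (2 * n + 1)) ∞ M]
    (S : AlmostContactMetricStructure (𝓡 (2 * n + 1)) M) (hS : S.IsKenmotsu)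
    (a : ℝ) (ha : 0 < a) (f lam : M → ℝ) (hf : ContMDiff (𝓡 (2 * n + 1)) 𝓘(ℝ, ℝ) ∞ f)
    (hsol : Riem.IsAlmostRicciSoliton (S.deform a ha).g (Riem.gradient (S.deform a ha).g f) lam)
    (x : M) :
    Riem.hsNormSq (S.deform a ha).g x (Riem.hessian (S.deform a ha).g f x)
        - 1 / (2 * (n : ℝ) + 1) * Riem.laplacian (S.deform a ha).g f x ^ 2
      ≤ Riem.hsNormSq (S.deform a ha).g x (Riem.ricci (S.deform a ha).g x) := by
  simpa using mainTheorem8_general (S.deform a ha).g f lam (hf.of_le (WithTop.coe_le_coe.2 le_top))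
    hsol x
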